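/- An \emph{ordered graph} is a finite simple graph together with a linear order on its vertices; two ordered graphs are isomorphic if some order-preserving bijection of their vertex sets preserves adjacency and non-adjacency. A \emph{property} of ordered graphs is a collection of ordered graphs closed under isomorphism; it is \emph{hereditary} if it is also closed under taking induced ordered subgraphs. Write $|\mathcal{P}_n|$ for the number of non-isomorphic ordered graphs on $n$ vertices in $\mathcal{P}$ (the \emph{speed} of $\mathcal{P}$), and let $\mathcal{P}^{(1,2)}$ consist of the members of $\mathcal{P}$ in which every vertex lies in at most one edge (and every edge has at most two vertices, which is automatic for graphs). Let $K_t$ be the complete ordered graph on $t$ vertices, let $K_{t,t}$ be the ordered graph on $\{1,\dots,2t\}$ with edge set $\{\{i,j\} : i \le t < j\}$, and for a permutation $\pi$ of $\{1,\dots,k\}$ let $H(\pi)$ be the ordered graph on $\{1,\dots,2k\}$ with edge set $\{\{i,\pi(i)+k\} : 1 \le i \le k\}$. Theorem. (i) Let $\mathcal{P}$ be a hereditary property of ordered graphs such that for some $t \in \mathbb{N}$ neither $K_t$ nor $K_{t,t}$ is in $\mathcal{P}$. If for every constant $c > 0$ there exists $N \in \mathbb{N}$ such that $|\mathcal{P}_N|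 > c^N$, then $\mathcal{P}$ contains $H(\pi)$ for every $k$ and every permutation $\pi$ of $\{1,\dots,k\}$, and $$|\mathcal{P}_n| \;\ge\; |\mathcal{P}^{(1,2)}_n| \;\ge\; \sum_{k=0}^{\lfloor n/2 \rfloor} \binom{n}{2k} k! \quad\text{for every } n \in \mathbb{N}.$$ (ii) $\displaystyle\sum_{k=0}^{\lfloor n/2 \rfloor} \binom{n}{2k} k! = n^{n/2 + o(n)}$ (with the convention $0^0=1$ at $n=0$). (iii) The lower bound is best possible, and is attained by a unique property: there is a hereditary property $\mathcal{Q}$ of ordered graphs that contains neither $K_t$ nor $K_{t,t}$ for any $t \ge 3$, satisfies the super-exponential growth hypothesis of (i), and has $|\mathcal{Q}_n| = \sum_{k=0}^{\lfloor n/2 \rfloor} \binom{n}{2k} k!$ for every $n \in \mathbb{N}$; and every hereditary property $\mathcal{P}$ of ordered graphs that, for some $t \in \mathbb{N}$, contains neither $K_t$ nor $K_{t,t}$ and that has this same speed for every $n$ is equal to $\mathcal{Q}$. -/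

import Mathlib

open Filter Asymptotics

/-- A (finite) ordered graph: a finite simple graph with a linear order on its vertices. -/
structure OrderedGraph where
  V : Type
  [fin : Finite V]
  [ord : LinearOrder V]
  graph : SimpleGraph V

attribute [instance] OrderedGraph.fin OrderedGraph.ord

namespace OrderedGraph

/-- `G` and `H` are isomorphic: some order isomorphism of the vertex sets preserves adjacency. -/
def Iso (G H : OrderedGraph) : Prop :=
  ∃ f : G.V ≃o H.V, ∀ a b, H.graph.Adj (f a) (f b) ↔ G.graph.Adj a b

theorem iso_equivalence : Equivalence Iso where
  refl G := ⟨OrderIso.refl _, fun _ _ => Iff.rfl⟩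
  symm := by
    rintro G H ⟨f, hf⟩
    exact ⟨f.symm, fun a b => by rw [← hf]; simp⟩
  trans := by
    rintro G H K ⟨f, hf⟩ ⟨g, hg⟩
    exact ⟨f.trans g, fun a b => by rw [← hf, ← hg]; rfl⟩

/-- Ordered graphs up to isomorphism. -/
def isoSetoid : Setoid OrderedGraph := ⟨Iso, iso_equivalence⟩

/-- The number of vertices. -/
noncomputable def order (G : OrderedGraph) : ℕ := Nat.card G.V

/-- The ordered subgraph of `G` induced by a set `U` of vertices, with the induced order. -/
def induced (G : OrderedGraph) (U : Set G.V) : OrderedGraph where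
  V := U
  graph := G.graph.induce U

/-- A property is a collection of ordered graphs closed under isomorphism. -/
def IsProperty (P : Set OrderedGraph) : Prop :=
  ∀ G H, G ∈ P → Iso G H → H ∈ P

/-- A hereditary property is a property closed under taking induced ordered subgraphs. -/
def IsHereditary (P : Set OrderedGraph) : Prop :=
  IsProperty P ∧ ∀ G ∈ P, ∀ U : Set G.V, G.induced U ∈ P

/-- The isomorphism classes of the ordered graphs on `n` vertices in `P`. -/
def classes (P : Set OrderedGraph) (n : ℕ) : Set (Quotient isoSetoid) :=
  Quotient.mk isoSetoid '' {G | G ∈ P ∧ G.order = n}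

/-- There are only finitely many ordered graphs on `n` vertices up to isomorphism. -/
theorem classes_finite (P : Set OrderedGraph) (n : ℕ) : (classes P n).Finite := by
  refine (Set.finite_range (fun g : SimpleGraph (Fin n) =>
    Quotient.mk isoSetoid (⟨Fin n, g⟩ : OrderedGraph))).subset ?_
  rintro _ ⟨G, ⟨-, hG⟩, rfl⟩
  have := Fintype.ofFinite G.V
  have hc : Fintype.card G.V = n := by rw [← hG, order, Nat.card_eq_fintype_card]
  let f := Fintype.orderIsoFinOfCardEq G.V hc
  exact ⟨G.graph.comap f, Quotient.sound ⟨f, fun a b => Iff.rfl⟩⟩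

/-- The speed of `P`: the number of non-isomorphic ordered graphs on `n` vertices in `P`. -/
noncomputable def speed (P : Set OrderedGraph) (n : ℕ) : ℕ := (classes P n).ncard

/-- The ordered graphs in `P` in which every vertex lies in at most `k` edges and every edge
has at most `l` vertices. -/
def sub (P : Set OrderedGraph) (k l : ℕ∞) : Set OrderedGraph :=
  {G | G ∈ P ∧ (∀ v, (G.graph.incidenceSet v).encard ≤ k) ∧
    ∀ e ∈ G.graph.edgeSet, {v | v ∈ e}.encard ≤ l}

/-- `P` has super-exponential speed: no exponential `c ^ n` bounds its speed. -/
def SuperExponential (P : Set OrderedGraph) : Prop :=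
  ∀ c : ℝ, 0 < c → ∃ N : ℕ, c ^ N < (speed P N : ℝ)

/-- The complete ordered graph `K_t`. -/
def K (t : ℕ) : OrderedGraph where
  V := Fin t
  graph := ⊤

/-- The complete bipartite ordered graph `K_{t,t}`: the first `t` of its `2t` vertices are joined
to the last `t`. -/
def Kbip (t : ℕ) : OrderedGraph where
  V := Fin (t + t)
  graph := SimpleGraph.fromRel fun i j => i.val < t ∧ t ≤ j.val

/-- The ordered graph `H(π)` on `2k` vertices, with edges `{i, π(i) + k}`. -/
def H {k : ℕ} (π : Equiv.Perm (Fin k)) : OrderedGraph where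
  V := Fin (k + k)
  graph := SimpleGraph.fromEdgeSet
    (Set.range fun i : Fin k => s(Fin.castAdd k i, Fin.natAdd k (π i)))

/-- `∑_{k = 0}^{⌊n/2⌋} C(n, 2k) k!`. -/
def bound (n : ℕ) : ℕ :=
  ∑ k ∈ Finset.range (n / 2 + 1), n.choose (2 * k) * k.factorial

end OrderedGraph

/-! On `Fin n` isomorphic ordered graphs are equal, so the speed counts graphs on `Fin n`, that is,
strictly upper triangular 0/1 matrices. If the matrices of all members of `P` avoid one fixed
permutation pattern, there are only exponentially many: such a matrix has O(n) ones
(`exists_card_le_of_not_containsPattern`), and Klazar's halving argument turns this into a bound c^n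
(`exists_card_avoiders_le`). A super-exponential `P` therefore meets every permutation pattern.

Pattern containment is not induced containment. So the pattern sought is π with one extra point,
which forces all rows used to precede all columns used, and with each point inflated to a long
increasing sequence. By Ramsey, omitting `K t` and `Kbip t` excludes large complete bipartite pieces
between consecutive vertex sets (`exists_bipartite_bound`). Bipartite Ramsey then thins the inflated
points until no unwanted edge is left, and one edge from each of them induces `H π`
(`exists_H_mem_of_inflation`).

Every member of `crossingMatchings` is an induced subgraph of some `H π`, hence lies in `P`. Such a
graph is determined by its 2k non-isolated vertices and a permutation of k, so its property has
speed exactly `bound`. It is the extremal property; a property with the same speed contains it and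
has equally many classes of each order, hence equals it. The asymptotics follow from ⌊n/2⌋! ≤ `bound
n` ≤ 4^n ⌊n/2⌋!. -/

/-! ### The Marcus–Tardos theorem -/

/-- The `0/1` matrix with support `M` contains the pattern of the bijection `σ`. -/
def ContainsPattern {ι κ : Type} [LinearOrder ι] [LinearOrder κ] (σ : ι ≃ κ)
    (M : Finset (ℕ × ℕ)) : Prop :=
  ∃ (a : ι → ℕ) (b : κ → ℕ), StrictMono a ∧ StrictMono b ∧ ∀ i, (a i, b (σ i)) ∈ M

/-- The support of the matrix obtained by contracting `s × s` blocks. -/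
def contractBlocks (s : ℕ) (M : Finset (ℕ × ℕ)) : Finset (ℕ × ℕ) :=
  M.image fun p => (p.1 / s, p.2 / s)

/-- The nonzero columns of the block `β`. -/
def blockCols (s : ℕ) (M : Finset (ℕ × ℕ)) (β : ℕ × ℕ) : Finset ℕ :=
  (M.filter fun p => (p.1 / s, p.2 / s) = β).image Prod.snd

/-- The nonzero rows of the block `β`. -/
def blockRows (s : ℕ) (M : Finset (ℕ × ℕ)) (β : ℕ × ℕ) : Finset ℕ :=
  (M.filter fun p => (p.1 / s, p.2 / s) = β).image Prod.fst

theorem exists_strictMono_mem (ι : Type) [Fintype ι] [LinearOrder ι] {α : Type*} [LinearOrder α]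
    (S : Finset α) (h : Fintype.card ι ≤ S.card) :
    ∃ f : ι → α, StrictMono f ∧ ∀ i, f i ∈ S := by
  let e := Fintype.orderIsoFinOfCardEq ι rfl
  refine ⟨fun i => S.orderEmbOfCardLe h (e.symm i), ?_, fun i => Finset.orderEmbOfCardLe_mem _ _ _⟩
  intro i j hij
  exact (S.orderEmbOfCardLe h).strictMono (e.symm.strictMono hij)

section

variable {ι κ : Type} [LinearOrder ι] [LinearOrder κ] {σ : ι ≃ κ}

/-- A permutation pattern uses each block row and block column once, so any choice of one entry per
block keeps the order. This makes both inductions on n possible. -/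
theorem ContainsPattern.of_contractBlocks {s : ℕ} {M : Finset (ℕ × ℕ)}
    (h : ContainsPattern σ (contractBlocks s M)) : ContainsPattern σ M := by
  obtain ⟨a, b, ha, hb, hab⟩ := h
  simp only [contractBlocks, Finset.mem_image, Prod.mk.injEq] at hab
  choose p hpM hpa hpb using hab
  refine ⟨fun i => (p i).1, fun j => (p (σ.symm j)).2, ?_, ?_, ?_⟩
  · intro i j hij
    have := ha hij
    rw [← hpa, ← hpa] at this
    exact lt_of_not_ge fun h => absurd (Nat.div_le_div_right h) this.not_ge
  · intro i j hij
    have := hb hij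
    rw [← σ.apply_symm_apply i, ← σ.apply_symm_apply j, ← hpb, ← hpb] at this
    exact lt_of_not_ge fun h => absurd (Nat.div_le_div_right h) this.not_ge
  · intro i
    simpa using hpM i

theorem ContainsPattern.of_swap {M : Finset (ℕ × ℕ)}
    (h : ContainsPattern σ.symm (M.image Prod.swap)) : ContainsPattern σ M := by
  obtain ⟨a, b, ha, hb, hab⟩ := h
  refine ⟨b, a, hb, ha, fun i => ?_⟩
  have := hab (σ i)
  simp only [Equiv.symm_apply_apply, Finset.mem_image] at this
  obtain ⟨p, hp, h⟩ := this
  rw [← Prod.swap_inj, Prod.swap_swap] at h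
  rw [h] at hp
  simpa using hp

theorem blockCols_subset {s : ℕ} (hs : 0 < s) (M : Finset (ℕ × ℕ)) (β : ℕ × ℕ) :
    blockCols s M β ⊆ Finset.Ico (β.2 * s) (β.2 * s + s) := by
  intro y hy
  simp only [blockCols, Finset.mem_image, Finset.mem_filter] at hy
  obtain ⟨p, ⟨-, rfl⟩, rfl⟩ := hy
  simp only [Finset.mem_Ico]
  have h1 := Nat.div_add_mod' p.2 s
  have h2 := Nat.mod_lt p.2 hs
  constructor <;> omega

theorem blockRows_eq (s : ℕ) (M : Finset (ℕ × ℕ)) (β : ℕ × ℕ) :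
    blockRows s M β = blockCols s (M.image Prod.swap) β.swap := by
  ext x
  simp only [blockRows, blockCols, Finset.mem_image, Finset.mem_filter, Prod.exists,
    Prod.ext_iff, Prod.fst_swap, Prod.snd_swap]
  grind

theorem card_blockCols_le {s : ℕ} (hs : 0 < s) (M : Finset (ℕ × ℕ)) (β : ℕ × ℕ) :
    (blockCols s M β).card ≤ s := by
  simpa using Finset.card_le_card (blockCols_subset hs M β)

theorem card_blockRows_le {s : ℕ} (hs : 0 < s) (M : Finset (ℕ × ℕ)) (β : ℕ × ℕ) :
    (blockRows s M β).card ≤ s := by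
  rw [blockRows_eq]
  exact card_blockCols_le hs _ _

/-- Pigeonhole: more than 2^s·k wide blocks in one block column would give k of them sharing a set
of at least k nonzero columns. These k columns and one row from each block then realise any pattern
of size k. -/
theorem card_wide_in_column [Fintype ι] [Fintype κ] {M : Finset (ℕ × ℕ)}
    (h : ¬ ContainsPattern σ M) {s : ℕ} (hs : 0 < s) (N c : ℕ) :
    ((Finset.range N).filter fun r => Fintype.card ι ≤ (blockCols s M (r, c)).card).card ≤
      2 ^ s * Fintype.card ι := by
  by_contra! hlt
  set W := (Finset.range N).filter fun r => Fintype.card ι ≤ (blockCols s M (r, c)).card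
  have hmaps : ∀ r ∈ W, blockCols s M (r, c) ∈ (Finset.Ico (c * s) (c * s + s)).powerset :=
    fun r _ => Finset.mem_powerset.2 (blockCols_subset hs M (r, c))
  obtain ⟨S, -, hS⟩ := Finset.exists_lt_card_fiber_of_mul_lt_card_of_maps_to hmaps
    (n := Fintype.card ι) (by simpa using hlt)
  obtain ⟨a, ha, haR⟩ := exists_strictMono_mem ι _ hS.le
  simp only [Finset.mem_filter, W] at haR
  have hcard : Fintype.card κ ≤ S.card := by
    rw [← Fintype.card_congr σ]
    obtain ⟨r, hr⟩ := Finset.card_pos.1 (Nat.zero_lt_of_lt hS)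
    simp only [Finset.mem_filter, W] at hr
    rw [← hr.2]
    exact hr.1.2
  obtain ⟨b, hb, hbS⟩ := exists_strictMono_mem κ S hcard
  have key : ∀ i, ∃ x, (x, b (σ i)) ∈ M ∧ x / s = a i := by
    intro i
    have := hbS (σ i)
    rw [← (haR i).2] at this
    simp only [blockCols, Finset.mem_image, Finset.mem_filter, Prod.mk.injEq] at this
    obtain ⟨p, ⟨hp, h1, -⟩, h2⟩ := this
    exact ⟨p.1, by rw [← h2]; exact hp, h1⟩
  choose x hxM hxa using key
  refine h ⟨x, b, fun i j hij => ?_, hb, hxM⟩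
  have := ha hij
  rw [← hxa, ← hxa] at this
  exact lt_of_not_ge fun h => absurd (Nat.div_le_div_right h) this.not_ge

theorem card_wide [Fintype ι] [Fintype κ] {M : Finset (ℕ × ℕ)}
    (h : ¬ ContainsPattern σ M) {s : ℕ} (hs : 0 < s) (N : ℕ) :
    ((Finset.range N ×ˢ Finset.range N).filter
      fun β => Fintype.card ι ≤ (blockCols s M β).card).card ≤ 2 ^ s * Fintype.card ι * N := by
  have := Finset.card_le_mul_card_image_of_maps_to (f := Prod.snd) (t := Finset.range N)
    (s := (Finset.range N ×ˢ Finset.range N).filter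
      fun β => Fintype.card ι ≤ (blockCols s M β).card)
    (fun β hβ => (Finset.mem_product.1 (Finset.mem_filter.1 hβ).1).2)
    (2 ^ s * Fintype.card ι) ?_
  · simpa using this
  · intro c _
    refine le_trans ?_ (card_wide_in_column h hs N c)
    refine Finset.card_le_card_of_injOn Prod.fst ?_ ?_
    · rintro ⟨r, c'⟩ hβ
      simp only [Finset.coe_filter, Finset.mem_filter, Finset.mem_product, Set.mem_ofPred_eq] at hβ ⊢
      obtain ⟨⟨⟨h1, h2⟩, h3⟩, rfl⟩ := hβ
      exact ⟨h1, h3⟩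
    · rintro ⟨r, c'⟩ hβ ⟨r', c''⟩ hβ' hr
      simp only [Finset.coe_filter, Finset.mem_filter, Set.mem_ofPred_eq] at hβ hβ' hr
      rw [hr, hβ.2, hβ'.2]

/-- Transposition turns tall blocks into wide ones and `σ` into `σ.symm`. -/
theorem card_tall [Fintype ι] [Fintype κ] {M : Finset (ℕ × ℕ)}
    (h : ¬ ContainsPattern σ M) {s : ℕ} (hs : 0 < s) (N : ℕ) :
    ((Finset.range N ×ˢ Finset.range N).filter
      fun β => Fintype.card ι ≤ (blockRows s M β).card).card ≤ 2 ^ s * Fintype.card ι * N := by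
  have hw := card_wide (fun h' => h (ContainsPattern.of_swap h')) hs N
  rw [← Fintype.card_congr σ] at hw
  refine le_trans (Finset.card_le_card_of_injOn Prod.swap ?_ Prod.swap_injective.injOn) hw
  intro β hβ
  simp only [Finset.coe_filter, Finset.mem_product, Set.mem_ofPred_eq, blockRows_eq] at hβ ⊢
  exact ⟨⟨hβ.1.2, hβ.1.1⟩, hβ.2⟩

theorem contractBlocks_subset {M : Finset (ℕ × ℕ)} {n s : ℕ}
    (hM : M ⊆ Finset.range n ×ˢ Finset.range n) {N : ℕ} (hN : ∀ x < n, x / s < N) :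
    contractBlocks s M ⊆ Finset.range N ×ˢ Finset.range N := by
  intro β hβ
  simp only [contractBlocks, Finset.mem_image] at hβ
  obtain ⟨p, hp, rfl⟩ := hβ
  have := hM hp
  simp only [Finset.mem_product, Finset.mem_range] at this ⊢
  exact ⟨hN _ this.1, hN _ this.2⟩

theorem card_le_card_contractBlocks [Fintype ι] [Fintype κ] {M : Finset (ℕ × ℕ)}
    (h : ¬ ContainsPattern σ M) {n s N : ℕ} (hs : 0 < s)
    (hM : M ⊆ Finset.range n ×ˢ Finset.range n) (hN : ∀ x < n, x / s < N) :
    M.card ≤ Fintype.card ι ^ 2 * (contractBlocks s M).card +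
      2 * (s ^ 2 * (2 ^ s * Fintype.card ι * N)) := by
  classical
  have hw0 := card_wide h hs N
  have ht0 := card_tall h hs N
  set k := Fintype.card ι
  have hsub := contractBlocks_subset hM hN
  -- A block neither wide nor tall has fewer than k nonzero rows and columns; the few others are
  -- charged their full area s².
  have hblock : ∀ β : ℕ × ℕ, (M.filter fun p => (p.1 / s, p.2 / s) = β).card ≤
      k ^ 2 + (s ^ 2 * (if k ≤ (blockCols s M β).card then 1 else 0) +
        s ^ 2 * (if k ≤ (blockRows s M β).card then 1 else 0)) := by
    intro β
    have h1 : (M.filter fun p => (p.1 / s, p.2 / s) = β).card ≤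
        (blockRows s M β).card * (blockCols s M β).card := by
      rw [← Finset.card_product]
      refine Finset.card_le_card fun p hp => ?_
      exact Finset.mem_product.2 ⟨Finset.mem_image_of_mem _ hp, Finset.mem_image_of_mem _ hp⟩
    refine h1.trans ?_
    have hc := card_blockCols_le hs M β
    have hr := card_blockRows_le hs M β
    have hcr := Nat.mul_le_mul hr hc
    rw [sq, sq]
    split_ifs with h2 h3 h3
    · omega
    · omega
    · omega
    · have := Nat.mul_le_mul (not_le.1 h3).le (not_le.1 h2).le
      omega
  have hsum : M.card = ∑ β ∈ contractBlocks s M,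
      (M.filter fun p => (p.1 / s, p.2 / s) = β).card :=
    Finset.card_eq_sum_card_image _ M
  rw [hsum]
  refine (Finset.sum_le_sum fun β _ => hblock β).trans ?_
  rw [Finset.sum_add_distrib, Finset.sum_add_distrib, Finset.sum_const, smul_eq_mul,
    ← Finset.mul_sum, ← Finset.mul_sum, ← Finset.card_filter, ← Finset.card_filter, mul_comm]
  have hw := (Finset.card_le_card (Finset.filter_subset_filter
    (fun β => k ≤ (blockCols s M β).card) hsub)).trans hw0
  have ht := (Finset.card_le_card (Finset.filter_subset_filter
    (fun β => k ≤ (blockRows s M β).card) hsub)).trans ht0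
  have hw' := Nat.mul_le_mul_left (s ^ 2) hw
  have ht' := Nat.mul_le_mul_left (s ^ 2) ht
  omega

variable (σ) in
/-- The Marcus–Tardos theorem. -/
theorem exists_card_le_of_not_containsPattern [Fintype ι] [Fintype κ] :
    ∃ C : ℕ, ∀ (n : ℕ) (M : Finset (ℕ × ℕ)), M ⊆ Finset.range n ×ˢ Finset.range n →
      ¬ ContainsPattern σ M → M.card ≤ C * n := by
  set k := Fintype.card ι with hk
  -- Since N·s ≤ 2n, this choice makes the recursive term k²·C·N at most half of C·n. The summand 4
  -- gives 2N ≤ n, so the recursion descends even for k = 0.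
  set s := 4 * k ^ 2 + 4 with hs
  set D := 2 * (s ^ 2 * (2 ^ s * k)) with hD
  -- The summand s settles n < s through n² ≤ s·n; 2D pays for the wide and tall blocks.
  refine ⟨s + 2 * D, fun n => ?_⟩
  induction n using Nat.strong_induction_on with
  | _ n ih =>
    intro M hM h
    rcases lt_or_ge n s with hn | hn
    · have h1 := Finset.card_le_card hM
      rw [Finset.card_product, Finset.card_range] at h1
      exact h1.trans (Nat.mul_le_mul_right _ (by omega))
    · have hN : ∀ x < n, x / s < n / s + 1 := fun x hx =>
        Nat.lt_succ_of_le (Nat.div_le_div_right hx.le)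
      have hdiv := Nat.div_mul_le_self n s
      set N := n / s + 1 with hNdef
      have hNs : N * s ≤ 2 * n := by rw [hNdef, add_mul]; omega
      have hNn : 2 * N ≤ n := by
        have : N * 4 ≤ N * s := Nat.mul_le_mul_left _ (by omega)
        omega
      have h1 := card_le_card_contractBlocks h (by omega) hM hN
      rw [← hk] at h1
      have h2 := ih N (by omega) _ (contractBlocks_subset hM hN)
        (fun h' => h h'.of_contractBlocks)
      have h3 := Nat.mul_le_mul_left (k ^ 2) h2
      have h4 : 2 * (k ^ 2 * ((s + 2 * D) * N)) ≤ (s + 2 * D) * n := by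
        have : (s + 2 * D) * (N * s) ≤ (s + 2 * D) * (2 * n) := Nat.mul_le_mul_left _ hNs
        rw [hs] at this ⊢
        nlinarith
      have h5 : 2 * (2 * (s ^ 2 * (2 ^ s * k * N))) ≤ (s + 2 * D) * n := by
        have e : 2 * (2 * (s ^ 2 * (2 ^ s * k * N))) = D * (2 * N) := by rw [hD]; ring
        rw [e]
        exact Nat.mul_le_mul (by omega) hNn
      omega

/-! ### Counting pattern-avoiding matrices -/

open Classical in
/-- The `n × n` matrices that avoid the pattern `σ`. -/
noncomputable def avoiders (σ : ι ≃ κ) (n : ℕ) : Finset (Finset (ℕ × ℕ)) :=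
  (Finset.range n ×ˢ Finset.range n).powerset.filter fun M => ¬ ContainsPattern σ M

theorem mem_avoiders {n : ℕ} {M : Finset (ℕ × ℕ)} : M ∈ avoiders σ n ↔
    M ⊆ Finset.range n ×ˢ Finset.range n ∧ ¬ ContainsPattern σ M := by
  simp [avoiders]

/-- Contraction of 2 × 2 blocks maps avoiders to avoiders. Its image has at most C·m ones, and a
preimage is a subset of the 4·C·m cells below them. -/
theorem card_avoiders_le_of_half {C : ℕ} (hC : ∀ (n : ℕ) (M : Finset (ℕ × ℕ)),
    M ⊆ Finset.range n ×ˢ Finset.range n → ¬ ContainsPattern σ M → M.card ≤ C * n)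
    {n m : ℕ} (hnm : n ≤ 2 * m) :
    (avoiders σ n).card ≤ 2 ^ (4 * (C * m)) * (avoiders σ m).card := by
  classical
  refine Finset.card_le_mul_card_image_of_maps_to (f := contractBlocks 2) ?_ _ ?_
  · intro M hM
    rw [mem_avoiders] at hM ⊢
    exact ⟨contractBlocks_subset hM.1 fun x hx => by omega, fun h => hM.2 h.of_contractBlocks⟩
  · intro M' hM'
    rw [mem_avoiders] at hM'
    have hcard := hC m M' hM'.1 hM'.2
    let f : (ℕ × ℕ) × Fin 2 × Fin 2 → ℕ × ℕ :=
      fun q => (2 * q.1.1 + q.2.1, 2 * q.1.2 + q.2.2)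
    set B := (M' ×ˢ (Finset.univ : Finset (Fin 2 × Fin 2))).image f
    have hB : B.card ≤ 4 * (C * m) := by
      refine Finset.card_image_le.trans ?_
      rw [Finset.card_product, Finset.card_univ]
      simp only [Fintype.card_prod, Fintype.card_fin]
      omega
    calc _ ≤ B.powerset.card := Finset.card_le_card ?_
      _ = 2 ^ B.card := Finset.card_powerset _
      _ ≤ _ := Nat.pow_le_pow_right (by norm_num) hB
    intro M hM
    rw [Finset.mem_filter] at hM
    rw [Finset.mem_powerset]
    intro p hp
    have hp' : (p.1 / 2, p.2 / 2) ∈ M' := by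
      rw [← hM.2]
      exact Finset.mem_image_of_mem _ hp
    refine Finset.mem_image.2 ⟨((p.1 / 2, p.2 / 2), (⟨p.1 % 2, by omega⟩, ⟨p.2 % 2, by omega⟩)),
      by simp [hp'], ?_⟩
    ext <;> simp [f] <;> omega

variable (σ) in
theorem exists_card_avoiders_le [Fintype ι] [Fintype κ] :
    ∃ c : ℕ, 0 < c ∧ ∀ n, (avoiders σ n).card ≤ c ^ n := by
  obtain ⟨C, hC⟩ := exists_card_le_of_not_containsPattern σ
  -- With m = ⌈n/2⌉ and d = n − m one has m ≤ 2d, so the loss 2^(4Cm) is at most (2^(8C))^d. The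
  -- factor 2 covers n = 1, where halving does not descend.
  refine ⟨2 * 2 ^ (8 * C), by positivity, fun n => ?_⟩
  induction n using Nat.strong_induction_on with
  | _ n ih =>
    have h0 : (avoiders σ n).card ≤ 2 ^ (n * n) := by
      have := Finset.card_le_card fun M hM =>
        Finset.mem_powerset.2 (mem_avoiders (σ := σ) (n := n).1 hM).1
      simpa using this
    match n, ih, h0 with
    | 0, _, h0 => simpa using h0
    | 1, _, h0 =>
      refine h0.trans ?_
      have : 0 < 2 ^ (8 * C) := by positivity
      simp only [mul_one, pow_one]
      omega
    | n + 2, ih, _ =>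
      set m := (n + 3) / 2 with hm
      obtain ⟨d, hd⟩ : ∃ d, n + 2 = m + d := ⟨n + 2 - m, by omega⟩
      calc _ ≤ 2 ^ (4 * (C * m)) * (avoiders σ m).card := card_avoiders_le_of_half hC (by omega)
        _ ≤ 2 ^ (4 * (C * m)) * (2 * 2 ^ (8 * C)) ^ m :=
          Nat.mul_le_mul_left _ (ih m (by omega))
        _ ≤ (2 * 2 ^ (8 * C)) ^ d * (2 * 2 ^ (8 * C)) ^ m := by
          refine Nat.mul_le_mul_right _ ?_
          calc 2 ^ (4 * (C * m)) ≤ 2 ^ (8 * C * d) := Nat.pow_le_pow_right (by norm_num) (by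
                have : C * m ≤ C * (2 * d) := Nat.mul_le_mul_left _ (by omega)
                linarith)
            _ = (2 ^ (8 * C)) ^ d := pow_mul _ _ _
            _ ≤ _ := Nat.pow_le_pow_left (by omega) _
        _ = _ := by rw [hd, ← pow_add, add_comm]

end

/-! ### Ramsey-type lemmas -/

theorem exists_clique_or_indepSet (a b : ℕ) : ∃ N : ℕ, ∀ {α : Type} (G : SimpleGraph α)
    (S : Finset α), N ≤ S.card →
      (∃ T ⊆ S, T.card = a ∧ G.IsClique T) ∨ (∃ T ⊆ S, T.card = b ∧ G.IsIndepSet T) := by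
  induction a generalizing b with
  | zero => exact ⟨0, fun G S _ => Or.inl ⟨∅, by simp, by simp, by simp⟩⟩
  | succ a iha =>
    induction b with
    | zero => exact ⟨0, fun G S _ => Or.inr ⟨∅, by simp, by simp, by simp [SimpleGraph.IsIndepSet]⟩⟩
    | succ b ihb =>
      obtain ⟨N₁, h₁⟩ := iha (b + 1)
      obtain ⟨N₂, h₂⟩ := ihb
      refine ⟨N₁ + N₂ + 1, fun {α} G S hS => ?_⟩
      classical
      obtain ⟨v, hv⟩ := Finset.card_pos.1 (by omega : 0 < S.card)
      have hsplit := Finset.card_filter_add_card_filter_not (s := S.erase v) (fun w => G.Adj v w)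
      rw [Finset.card_erase_of_mem hv] at hsplit
      have hsub : ∀ (p : α → Prop) [DecidablePred p], ∀ T ⊆ (S.erase v).filter p, insert v T ⊆ S ∧ v ∉ T := by
        intro p _ T hT
        refine ⟨Finset.insert_subset hv fun x hx => ?_, fun hvT => ?_⟩
        · exact Finset.mem_of_mem_erase (Finset.mem_filter.1 (hT hx)).1
        · simpa using hT hvT
      rcases le_or_gt N₁ ((S.erase v).filter fun w => G.Adj v w).card with h | h
      · rcases h₁ G _ h with ⟨T, hT, hc, hT'⟩ | ⟨T, hT, hc, hT'⟩
        · obtain ⟨h3, h4⟩ := hsub _ T hT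
          refine Or.inl ⟨insert v T, h3, by rw [Finset.card_insert_of_notMem h4, hc], ?_⟩
          rw [Finset.coe_insert]
          exact hT'.insert fun w hw _ => (Finset.mem_filter.1 (hT hw)).2
        · exact Or.inr ⟨T, fun x hx => Finset.mem_of_mem_erase (Finset.mem_filter.1 (hT hx)).1,
            hc, hT'⟩
      · rcases h₂ G ((S.erase v).filter fun w => ¬ G.Adj v w) (by omega) with
          ⟨T, hT, hc, hT'⟩ | ⟨T, hT, hc, hT'⟩
        · exact Or.inl ⟨T, fun x hx => Finset.mem_of_mem_erase (Finset.mem_filter.1 (hT hx)).1,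
            hc, hT'⟩
        · obtain ⟨h3, h4⟩ := hsub _ T hT
          refine Or.inr ⟨insert v T, h3, by rw [Finset.card_insert_of_notMem h4, hc], ?_⟩
          rw [Finset.coe_insert]
          refine Set.Pairwise.insert hT' fun w hw _ => ?_
          have := (Finset.mem_filter.1 (hT hw)).2
          exact ⟨this, fun h' => this h'.symm⟩

/-- More than r elements of Y have the same neighbourhood A in a fixed 2r-subset of X; either A or
its complement there has r elements. -/
theorem exists_bipartite_homogeneous (r : ℕ) : ∃ N : ℕ, ∀ {α : Type} (R : α → α → Prop)
    (X Y : Finset α), N ≤ X.card → N ≤ Y.card →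
      ∃ X' ⊆ X, ∃ Y' ⊆ Y, X'.card = r ∧ Y'.card = r ∧
        ((∀ x ∈ X', ∀ y ∈ Y', R x y) ∨ ∀ x ∈ X', ∀ y ∈ Y', ¬ R x y) := by
  refine ⟨2 * r + (2 ^ (2 * r) * r + 1), fun {α} R X Y hX hY => ?_⟩
  classical
  obtain ⟨X₀, hX₀, hc⟩ := Finset.exists_subset_card_eq (by omega : 2 * r ≤ X.card)
  obtain ⟨A, hA, hfib⟩ := Finset.exists_lt_card_fiber_of_mul_lt_card_of_maps_to
    (f := fun y => X₀.filter fun x => R x y) (s := Y) (t := X₀.powerset) (n := r)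
    (fun y _ => Finset.mem_powerset.2 (Finset.filter_subset _ _))
    (by rw [Finset.card_powerset, hc]; omega)
  obtain ⟨Y', hY', hcY⟩ := Finset.exists_subset_card_eq hfib.le
  have hYsub : Y' ⊆ Y := hY'.trans (Finset.filter_subset _ _)
  have hmem : ∀ y ∈ Y', ∀ x ∈ X₀, (x ∈ A ↔ R x y) := by
    intro y hy x hx
    rw [← (Finset.mem_filter.1 (hY' hy)).2, Finset.mem_filter, and_iff_right hx]
  have hA' := Finset.mem_powerset.1 hA
  have hsum := Finset.card_sdiff_add_card_eq_card hA'
  rcases le_or_gt r A.card with h | h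
  · obtain ⟨X', hX', hcX⟩ := Finset.exists_subset_card_eq h
    exact ⟨X', (hX'.trans hA').trans hX₀, Y', hYsub, hcX, hcY,
      Or.inl fun x hx y hy => (hmem y hy x (hA' (hX' hx))).1 (hX' hx)⟩
  · obtain ⟨X', hX', hcX⟩ := Finset.exists_subset_card_eq (by omega : r ≤ (X₀ \ A).card)
    refine ⟨X', (hX'.trans Finset.sdiff_subset).trans hX₀, Y', hYsub, hcX, hcY,
      Or.inr fun x hx y hy hR => ?_⟩
    have := Finset.mem_sdiff.1 (hX' hx)
    exact this.2 ((hmem y hy x this.1).2 hR)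

/-- If none of finitely many bipartite relations between large classes contains a complete
bipartite relation of size `r₀`, then there are subclasses of size `r` with no relations. -/
theorem exists_unrelated_subsets {I J : Type} [DecidableEq J] (src tgt : I → J) (r₀ : ℕ)
    (s : Finset I) (r : ℕ) : ∃ m : ℕ, ∀ {α : Type} (R : I → α → α → Prop) (X : J → Finset α),
      (∀ j, m ≤ (X j).card) → (∀ i, src i = tgt i → ∀ x y, ¬ R i x y) →
      (∀ i (A B : Finset α), A.card = r₀ → B.card = r₀ → ∃ x ∈ A, ∃ y ∈ B, ¬ R i x y) →
      ∃ X' : J → Finset α, (∀ j, X' j ⊆ X j ∧ r ≤ (X' j).card) ∧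
        ∀ i ∈ s, ∀ x ∈ X' (src i), ∀ y ∈ X' (tgt i), ¬ R i x y := by
  classical
  induction s using Finset.induction_on generalizing r with
  | empty => exact ⟨r, fun R X hX _ _ => ⟨X, fun j => ⟨subset_rfl, hX j⟩, by simp⟩⟩
  | insert i s _ ih =>
    obtain ⟨N, hN⟩ := exists_bipartite_homogeneous (max r₀ r)
    obtain ⟨m, hm⟩ := ih (max N r)
    refine ⟨m, fun {α} R X hX hloop hfree => ?_⟩
    obtain ⟨X', hX', hR⟩ := hm R X hX hloop hfree
    -- With equal indices the two subclasses could not be chosen separately; that case is void by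
    -- hypothesis.
    by_cases hi : src i = tgt i
    · refine ⟨X', fun j => ⟨(hX' j).1, (le_max_right _ _).trans (hX' j).2⟩, fun i' hi' => ?_⟩
      rcases Finset.mem_insert.1 hi' with rfl | hi'
      · exact fun x _ y _ => hloop i' hi x y
      · exact hR i' hi'
    · obtain ⟨A, hA, B, hB, hcA, hcB, h⟩ := hN (R i) (X' (src i)) (X' (tgt i))
        ((le_max_left _ _).trans (hX' _).2) ((le_max_left _ _).trans (hX' _).2)
      have hAB : ∀ x ∈ A, ∀ y ∈ B, ¬ R i x y := by
        refine h.resolve_left fun h => ?_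
        obtain ⟨A₀, hA₀, hcA₀⟩ := Finset.exists_subset_card_eq (le_max_left r₀ r |>.trans hcA.ge)
        obtain ⟨B₀, hB₀, hcB₀⟩ := Finset.exists_subset_card_eq (le_max_left r₀ r |>.trans hcB.ge)
        obtain ⟨x, hx, y, hy, hxy⟩ := hfree i A₀ B₀ hcA₀ hcB₀
        exact hxy (h x (hA₀ hx) y (hB₀ hy))
      set X'' := Function.update (Function.update X' (src i) A) (tgt i) B with hX''
      have hsrc : X'' (src i) = A := by simp [hX'', hi]
      have htgt : X'' (tgt i) = B := by simp [hX'']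
      have hsub : ∀ j, X'' j ⊆ X' j ∧ r ≤ (X'' j).card := by
        intro j
        by_cases h1 : j = tgt i
        · subst h1
          rw [htgt]
          exact ⟨hB, (le_max_right _ _).trans hcB.ge⟩
        by_cases h2 : j = src i
        · subst h2
          rw [hsrc]
          exact ⟨hA, (le_max_right _ _).trans hcA.ge⟩
        · simp only [hX'', Function.update_of_ne h1, Function.update_of_ne h2]
          exact ⟨subset_rfl, (le_max_right _ _).trans (hX' j).2⟩
      refine ⟨X'', fun j => ⟨(hsub j).1.trans (hX' j).1, (hsub j).2⟩, fun i' hi' => ?_⟩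
      rcases Finset.mem_insert.1 hi' with rfl | hi'
      · rw [hsrc, htgt]
        exact hAB
      · exact fun x hx y hy => hR i' hi' x ((hsub _).1 hx) y ((hsub _).1 hy)

namespace OrderedGraph

/-! ### Hereditary properties and speeds -/

/-- The ordered graph on `Fin n` with the given edges. -/
def ofGraph {n : ℕ} (g : SimpleGraph (Fin n)) : OrderedGraph := ⟨Fin n, g⟩

theorem IsHereditary.mem_of_embedding {P : Set OrderedGraph} (hP : IsHereditary P)
    {F G : OrderedGraph} (hG : G ∈ P) (f : F.V → G.V) (hf : StrictMono f)
    (hadj : ∀ a b, G.graph.Adj (f a) (f b) ↔ F.graph.Adj a b) : F ∈ P := by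
  refine hP.1 _ _ (hP.2 G hG (Set.range f)) (iso_equivalence.symm ?_)
  exact ⟨hf.orderIso f, fun a b => hadj a b⟩

theorem exists_iso_ofGraph {G : OrderedGraph} {n : ℕ} (hG : G.order = n) :
    ∃ g : SimpleGraph (Fin n), Iso (ofGraph g) G := by
  have := Fintype.ofFinite G.V
  have hc : Fintype.card G.V = n := by rw [← hG, order, Nat.card_eq_fintype_card]
  let f := Fintype.orderIsoFinOfCardEq G.V hc
  exact ⟨G.graph.comap f, f, fun a b => Iff.rfl⟩

/-- A finite linear order has no nontrivial automorphism, so no symmetry has to be divided out in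
counting. -/
theorem ofGraph_iso_iff {n : ℕ} {g g' : SimpleGraph (Fin n)} :
    Iso (ofGraph g) (ofGraph g') ↔ g = g' := by
  constructor
  · rintro ⟨f, hf⟩
    have : f = OrderIso.refl (Fin n) := Subsingleton.elim (α := Fin n ≃o Fin n) _ _
    subst this
    ext a b
    exact (hf a b).symm
  · rintro rfl
    exact iso_equivalence.refl _

theorem speed_eq {P : Set OrderedGraph} (hP : IsProperty P) (n : ℕ) :
    speed P n = {g : SimpleGraph (Fin n) | ofGraph g ∈ P}.ncard := by
  have : classes P n = (fun g : SimpleGraph (Fin n) => Quotient.mk isoSetoid (ofGraph g)) ''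
      {g | ofGraph g ∈ P} := by
    ext q
    constructor
    · rintro ⟨G, ⟨hG, hn⟩, rfl⟩
      obtain ⟨g, hg⟩ := exists_iso_ofGraph hn
      exact ⟨g, hP _ _ hG (iso_equivalence.symm hg), Quotient.sound hg⟩
    · rintro ⟨g, hg, rfl⟩
      exact ⟨ofGraph g, ⟨hg, by simp [order, ofGraph]⟩, rfl⟩
  rw [speed, this]
  exact Set.ncard_image_of_injective _ fun g g' h => ofGraph_iso_iff.1 (Quotient.exact h)

theorem classes_mono {P P' : Set OrderedGraph} (h : P ⊆ P') (n : ℕ) :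
    classes P n ⊆ classes P' n :=
  Set.image_mono fun _ hG => ⟨h hG.1, hG.2⟩

theorem speed_mono {P P' : Set OrderedGraph} (h : P ⊆ P') (n : ℕ) : speed P n ≤ speed P' n :=
  Set.ncard_le_ncard (classes_mono h n) (classes_finite P' n)

theorem H_adj {k : ℕ} (π : Equiv.Perm (Fin k)) (x y : Fin (k + k)) :
    (H π).graph.Adj x y ↔ ∃ i, (x = Fin.castAdd k i ∧ y = Fin.natAdd k (π i)) ∨
      (x = Fin.natAdd k (π i) ∧ y = Fin.castAdd k i) := by
  have hne : ∀ i j, Fin.castAdd k i ≠ Fin.natAdd k j := by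
    intro i j h
    have := congrArg Fin.val h
    simp at this
    omega
  simp only [H, SimpleGraph.fromEdgeSet_adj, Set.mem_range, Sym2.eq_iff]
  constructor
  · rintro ⟨⟨i, ⟨rfl, rfl⟩ | ⟨rfl, rfl⟩⟩, -⟩
    exacts [⟨i, Or.inl ⟨rfl, rfl⟩⟩, ⟨i, Or.inr ⟨rfl, rfl⟩⟩]
  · rintro ⟨i, ⟨rfl, rfl⟩ | ⟨rfl, rfl⟩⟩
    exacts [⟨⟨i, Or.inl ⟨rfl, rfl⟩⟩, hne _ _⟩, ⟨⟨i, Or.inr ⟨rfl, rfl⟩⟩, (hne _ _).symm⟩]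

theorem strictMono_addCases {α : Type*} [Preorder α] {m n : ℕ} {f : Fin m → α} {g : Fin n → α}
    (hf : StrictMono f) (hg : StrictMono g) (hfg : ∀ i j, f i < g j) :
    StrictMono (Fin.addCases f g : Fin (m + n) → α) := by
  intro x y hxy
  induction x using Fin.addCases with
  | left i =>
    induction y using Fin.addCases with
    | left j => simpa using hf ((Fin.castAddOrderEmb n).lt_iff_lt.1 hxy)
    | right j => simpa using hfg i j
  | right i =>
    induction y using Fin.addCases with
    | left j =>
      rw [Fin.lt_def] at hxy
      simp at hxy
      omega
    | right j => simpa using hg ((Fin.natAddOrderEmb m).lt_iff_lt.1 hxy)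

theorem Kbip_adj {t : ℕ} (x y : Fin (t + t)) : (Kbip t).graph.Adj x y ↔
    x ≠ y ∧ ((x.val < t ∧ t ≤ y.val) ∨ (y.val < t ∧ t ≤ x.val)) :=
  SimpleGraph.fromRel_adj _ _ _

/-- Ramsey inside each side gives t independent vertices, since a clique would be `K t`. A complete
relation between them would induce `Kbip t`. -/
theorem exists_bipartite_bound {P : Set OrderedGraph} (hP : IsHereditary P) {t : ℕ}
    (hK : K t ∉ P) (hB : Kbip t ∉ P) : ∃ r : ℕ, ∀ G ∈ P, ∀ S T : Finset G.V,
      S.card = r → T.card = r → (∀ x ∈ S, ∀ y ∈ T, x < y) →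
      ∃ x ∈ S, ∃ y ∈ T, ¬ G.graph.Adj x y := by
  obtain ⟨r, hr⟩ := exists_clique_or_indepSet t t
  refine ⟨r, fun G hG S T hS hT hlt => ?_⟩
  by_contra! hadj
  have key : ∀ S : Finset G.V, S.card = r →
      ∃ S' ⊆ S, S'.card = t ∧ G.graph.IsIndepSet S' := by
    intro S hS
    refine (hr G.graph S hS.ge).resolve_left ?_
    rintro ⟨S', -, hc, hcl⟩
    refine hK (hP.mem_of_embedding hG (S'.orderEmbOfFin hc) (S'.orderEmbOfFin hc).strictMono ?_)
    intro a b
    simp only [K]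
    constructor
    · rintro h rfl
      exact G.graph.loopless.irrefl _ h
    · exact fun h => hcl (S'.orderEmbOfFin_mem hc a) (S'.orderEmbOfFin_mem hc b)
        fun h' => h ((S'.orderEmbOfFin hc).injective h')
  obtain ⟨S', hS', hcS, hiS⟩ := key S hS
  obtain ⟨T', hT', hcT, hiT⟩ := key T hT
  have hi : ∀ A : Finset G.V, G.graph.IsIndepSet A → ∀ x ∈ A, ∀ y ∈ A, ¬ G.graph.Adj x y :=
    fun A hA x hx y hy hxy => hA hx hy hxy.ne hxy
  have hmS := S'.orderEmbOfFin_mem hcS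
  have hmT := T'.orderEmbOfFin_mem hcT
  refine hB (hP.mem_of_embedding hG
    (Fin.addCases (S'.orderEmbOfFin hcS) (T'.orderEmbOfFin hcT) : Fin (t + t) → G.V)
    (strictMono_addCases (S'.orderEmbOfFin hcS).strictMono (T'.orderEmbOfFin hcT).strictMono
      fun i j => hlt _ (hS' (hmS i)) _ (hT' (hmT j))) ?_)
  intro (x : Fin (t + t)) (y : Fin (t + t))
  rw [Kbip_adj]
  induction x using Fin.addCases with
  | left i =>
    induction y using Fin.addCases with
    | left j =>
      rw [Fin.addCases_left, Fin.addCases_left]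
      refine iff_of_false (hi _ hiS _ (hmS i) _ (hmS j)) ?_
      simp only [Fin.val_castAdd]
      omega
    | right j =>
      rw [Fin.addCases_left, Fin.addCases_right]
      refine iff_of_true (hadj _ (hS' (hmS i)) _ (hT' (hmT j))) ?_
      simp only [Fin.val_natAdd, Fin.val_castAdd, ne_eq, Fin.ext_iff]
      omega
  | right i =>
    induction y using Fin.addCases with
    | left j =>
      rw [Fin.addCases_left, Fin.addCases_right]
      refine iff_of_true (hadj _ (hS' (hmS j)) _ (hT' (hmT i))).symm ?_
      simp only [Fin.val_natAdd, Fin.val_castAdd, ne_eq, Fin.ext_iff]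
      omega
    | right j =>
      rw [Fin.addCases_right, Fin.addCases_right]
      refine iff_of_false (hi _ hiT _ (hmT i) _ (hmT j)) ?_
      simp only [Fin.val_natAdd]
      omega

/-- A graph in `P` containing a large (not necessarily induced) inflation of `H π` contains `H π`
as an induced subgraph, provided that `P` has no large complete bipartite subgraphs. -/
theorem exists_H_mem_of_inflation {P : Set OrderedGraph} (hP : IsHereditary P) {r : ℕ}
    (hr : ∀ G ∈ P, ∀ S T : Finset G.V, S.card = r → T.card = r → (∀ x ∈ S, ∀ y ∈ T, x < y) →
      ∃ x ∈ S, ∃ y ∈ T, ¬ G.graph.Adj x y) {k : ℕ} (π : Equiv.Perm (Fin k)) :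
    ∃ m : ℕ, ∀ G ∈ P, ∀ U W : Fin k → Fin m → G.V, (∀ p, StrictMono (U p)) →
      (∀ p, StrictMono (W p)) → (∀ p q x y, p < q → U p x < U q y) →
      (∀ p q x y, π p < π q → W p x < W q y) → (∀ p q x y, U p x < W q y) →
      (∀ p x, G.graph.Adj (U p x) (W p x)) → H π ∈ P := by
  obtain ⟨m, hm⟩ := exists_unrelated_subsets (I := Fin 3 × Fin k × Fin k) (fun i => i.2.1)
    (fun i => i.2.2) r Finset.univ 1
  refine ⟨m, fun G hG U W hU hW hUU hWW hUW hadj => ?_⟩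
  -- The three unwanted kinds of edge: U–U, W–W, and U–W with different indices. A single index set
  -- per p thins `U p` and `W p` together, so the matching edges survive. The order conditions leave
  -- only pairs of consecutive classes, to which `hr` applies.
  let R : Fin 3 × Fin k × Fin k → Fin m → Fin m → Prop := fun i x y =>
    ![i.2.1 < i.2.2 ∧ G.graph.Adj (U i.2.1 x) (U i.2.2 y),
      π i.2.1 < π i.2.2 ∧ G.graph.Adj (W i.2.1 x) (W i.2.2 y),
      i.2.1 ≠ i.2.2 ∧ G.graph.Adj (U i.2.1 x) (W i.2.2 y)] i.1
  have hfree : ∀ f g : Fin m → G.V, StrictMono f → StrictMono g → ∀ A B : Finset (Fin m),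
      A.card = r → B.card = r → (∀ x ∈ A, ∀ y ∈ B, f x < g y) →
      (∀ x ∈ A, ∀ y ∈ B, G.graph.Adj (f x) (g y)) → False := by
    intro f g hf hg A B hA hB hlt hadj
    obtain ⟨x, hx, y, hy, hxy⟩ := hr G hG (A.image f) (B.image g)
      (by rw [Finset.card_image_of_injective _ hf.injective, hA])
      (by rw [Finset.card_image_of_injective _ hg.injective, hB])
      (by simpa using hlt)
    obtain ⟨x, hx', rfl⟩ := Finset.mem_image.1 hx
    obtain ⟨y, hy', rfl⟩ := Finset.mem_image.1 hy
    exact hxy (hadj x hx' y hy')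
  have hloop : ∀ i : Fin 3 × Fin k × Fin k, i.2.1 = i.2.2 → ∀ x y, ¬ R i x y := by
    rintro ⟨τ, p, q⟩ (rfl : p = q) x y
    fin_cases τ <;> simp [R]
  have hcomp : ∀ i (A B : Finset (Fin m)), A.card = r → B.card = r →
      ∃ x ∈ A, ∃ y ∈ B, ¬ R i x y := by
    rintro ⟨τ, p, q⟩ A B hA hB
    by_contra! h
    fin_cases τ
    · exact hfree (U p) (U q) (hU p) (hU q) A B hA hB
        (fun x hx y hy => hUU p q x y (h x hx y hy).1) fun x hx y hy => (h x hx y hy).2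
    · exact hfree (W p) (W q) (hW p) (hW q) A B hA hB
        (fun x hx y hy => hWW p q x y (h x hx y hy).1) fun x hx y hy => (h x hx y hy).2
    · exact hfree (U p) (W q) (hU p) (hW q) A B hA hB
        (fun x hx y hy => hUW p q x y) fun x hx y hy => (h x hx y hy).2
  obtain ⟨X, hX, hR⟩ := hm R (fun _ => Finset.univ) (by simp) hloop hcomp
  have hne : ∀ p, ∃ x, x ∈ X p := fun p => Finset.card_pos.1 (hX p).2
  choose x hx using hne
  have hR0 : ∀ p q, p < q → ¬ G.graph.Adj (U p (x p)) (U q (x q)) := fun p q hpq h =>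
    hR (0, p, q) (Finset.mem_univ _) _ (hx p) _ (hx q) ⟨hpq, h⟩
  have hR1 : ∀ p q, π p < π q → ¬ G.graph.Adj (W p (x p)) (W q (x q)) := fun p q hpq h =>
    hR (1, p, q) (Finset.mem_univ _) _ (hx p) _ (hx q) ⟨hpq, h⟩
  have hR2 : ∀ p q, p ≠ q → ¬ G.graph.Adj (U p (x p)) (W q (x q)) := fun p q hpq h =>
    hR (2, p, q) (Finset.mem_univ _) _ (hx p) _ (hx q) ⟨hpq, h⟩
  have hUU' : ∀ p q, ¬ G.graph.Adj (U p (x p)) (U q (x q)) := by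
    intro p q h
    rcases lt_trichotomy p q with hpq | rfl | hpq
    exacts [hR0 p q hpq h, h.ne rfl, hR0 q p hpq h.symm]
  have hWW' : ∀ p q, ¬ G.graph.Adj (W p (x p)) (W q (x q)) := by
    intro p q h
    rcases lt_trichotomy (π p) (π q) with hpq | hpq | hpq
    · exact hR1 p q hpq h
    · rw [π.injective hpq] at h
      exact h.ne rfl
    · exact hR1 q p hpq h.symm
  have hUW' : ∀ p q, G.graph.Adj (U p (x p)) (W q (x q)) ↔ p = q :=
    fun p q => ⟨fun h => by_contra fun hpq => hR2 p q hpq h, by rintro rfl; exact hadj _ _⟩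
  refine hP.mem_of_embedding hG (Fin.addCases (fun p => U p (x p))
    (fun j => W (π.symm j) (x (π.symm j))) : Fin (k + k) → G.V)
    (strictMono_addCases (fun p q hpq => hUU _ _ _ _ hpq)
      (fun p q hpq => hWW _ _ _ _ (by simpa using hpq)) fun _ _ => hUW _ _ _ _) ?_
  intro (a : Fin (k + k)) (b : Fin (k + k))
  rw [H_adj]
  induction a using Fin.addCases with
  | left i =>
    induction b using Fin.addCases with
    | left j =>
      simp only [Fin.addCases_left, hUU', false_iff, not_exists, not_or, not_and, Fin.ext_iff,
        Fin.val_castAdd, Fin.val_natAdd]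
      omega
    | right j =>
      simp only [Fin.addCases_left, Fin.addCases_right, hUW', Equiv.eq_symm_apply]
      constructor
      · intro h
        exact ⟨i, Or.inl ⟨rfl, by rw [h]⟩⟩
      · rintro ⟨i', ⟨h1, h2⟩ | ⟨h1, -⟩⟩
        · rw [Fin.castAdd_injective _ _ h1, ← Fin.natAdd_injective _ _ h2]
        · have := congrArg Fin.val h1
          simp at this
          omega
  | right i =>
    induction b using Fin.addCases with
    | left j =>
      simp only [Fin.addCases_left, Fin.addCases_right, SimpleGraph.adj_comm _ (W _ _), hUW',
        Equiv.eq_symm_apply]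
      constructor
      · intro h
        exact ⟨j, Or.inr ⟨by rw [h], rfl⟩⟩
      · rintro ⟨i', ⟨h1, -⟩ | ⟨h1, h2⟩⟩
        · have := congrArg Fin.val h1
          simp at this
          omega
        · rw [Fin.castAdd_injective _ _ h2, ← Fin.natAdd_injective _ _ h1]
    | right j =>
      simp only [Fin.addCases_right, hWW', false_iff, not_exists, not_or, not_and, Fin.ext_iff,
        Fin.val_castAdd, Fin.val_natAdd]
      omega

/-! ### Super-exponential properties contain all `H π` -/

open Classical in
/-- The support of the strictly upper triangular part of the adjacency matrix. -/
noncomputable def upperSupport {n : ℕ} (g : SimpleGraph (Fin n)) : Finset (ℕ × ℕ) :=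
  ((Finset.univ : Finset (Fin n × Fin n)).filter fun e => e.1 < e.2 ∧ g.Adj e.1 e.2).image
    fun e => (e.1.val, e.2.val)

theorem mem_upperSupport {n : ℕ} {g : SimpleGraph (Fin n)} {x y : ℕ} :
    (x, y) ∈ upperSupport g ↔ ∃ i j : Fin n, i < j ∧ g.Adj i j ∧ i.val = x ∧ j.val = y := by
  simp [upperSupport, and_assoc]

theorem upperSupport_injective (n : ℕ) :
    Function.Injective (upperSupport : SimpleGraph (Fin n) → Finset (ℕ × ℕ)) := by
  intro g g' h
  have key : ∀ {g : SimpleGraph (Fin n)} {i j : Fin n}, i < j →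
      (g.Adj i j ↔ (i.val, j.val) ∈ upperSupport g) := by
    intro g i j hij
    rw [mem_upperSupport]
    constructor
    · exact fun h => ⟨i, j, hij, h, rfl, rfl⟩
    · rintro ⟨i', j', -, h, h1, h2⟩
      rwa [← Fin.ext h1, ← Fin.ext h2]
  ext i j
  rcases lt_trichotomy i j with hij | rfl | hij
  · rw [key hij, key hij, h]
  · simp
  · rw [g.adj_comm, g'.adj_comm, key hij, key hij, h]

theorem upperSupport_subset {n : ℕ} (g : SimpleGraph (Fin n)) :
    upperSupport g ⊆ Finset.range n ×ˢ Finset.range n := by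
  rintro ⟨x, y⟩ h
  obtain ⟨i, j, -, -, rfl, rfl⟩ := mem_upperSupport.1 h
  simp

/-- The permutation `i ↦ π i + 1` for `i < k`, `k ↦ 0`. -/
def shiftPerm {k : ℕ} (π : Equiv.Perm (Fin k)) : Equiv.Perm (Fin (k + 1)) :=
  (finSuccEquivLast.trans (Equiv.optionCongr π)).trans (finSuccEquiv k).symm

theorem shiftPerm_castSucc {k : ℕ} (π : Equiv.Perm (Fin k)) (i : Fin k) :
    shiftPerm π i.castSucc = (π i).succ := by
  simp [shiftPerm]

theorem shiftPerm_last {k : ℕ} (π : Equiv.Perm (Fin k)) : shiftPerm π (Fin.last k) = 0 := by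
  simp [shiftPerm]

/-- Replace every point of `shiftPerm π` by an increasing sequence of length `m`. -/
def inflation {k : ℕ} (π : Equiv.Perm (Fin k)) (m : ℕ) :
    Lex (Fin (k + 1) × Fin m) ≃ Lex (Fin (k + 1) × Fin m) :=
  (ofLex.trans ((shiftPerm π).prodCongr (Equiv.refl _))).trans toLex

/-- Rows and columns of a pattern may interleave as vertices. The extra point of `shiftPerm π` lies
in the last row and the first column, and its entry is above the diagonal, so every other row
precedes every other column. -/
theorem exists_forall_not_containsPattern {P : Set OrderedGraph} (hP : IsHereditary P) {t : ℕ}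
    (hK : K t ∉ P) (hB : Kbip t ∉ P) {k : ℕ} {π : Equiv.Perm (Fin k)} (hπ : H π ∉ P) :
    ∃ m : ℕ, ∀ (n : ℕ) (g : SimpleGraph (Fin n)), ofGraph g ∈ P →
      ¬ ContainsPattern (inflation π m) (upperSupport g) := by
  obtain ⟨r, hr⟩ := exists_bipartite_bound hP hK hB
  obtain ⟨m, hm⟩ := exists_H_mem_of_inflation hP hr π
  -- One more than needed, so that the extra point has a nonempty inflation even when m = 0.
  refine ⟨m + 1, fun n g hg hcon => hπ ?_⟩
  obtain ⟨a, b, ha, hb, hab⟩ := hcon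
  simp only [mem_upperSupport] at hab
  choose u w huw hadj hua hwb using hab
  have hlast : ∀ p : Fin k, p.castSucc < Fin.last k := Fin.castSucc_lt_last
  have hult : ∀ i j, i < j → u i < u j := fun i j hij => by
    rw [Fin.lt_def, hua, hua]
    exact ha hij
  have hwlt : ∀ i j, inflation π (m + 1) i < inflation π (m + 1) j → w i < w j :=
    fun i j hij => by
      rw [Fin.lt_def, hwb, hwb]
      exact hb hij
  refine hm (ofGraph g) hg (fun p x => u (toLex (p.castSucc, x.castSucc)))
    (fun p x => w (toLex (p.castSucc, x.castSucc))) ?_ ?_ ?_ ?_ ?_ ?_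
  · intro p x y hxy
    exact hult _ _ (Prod.Lex.toLex_lt_toLex.2 (Or.inr ⟨rfl, Fin.castSucc_lt_castSucc_iff.2 hxy⟩))
  · intro p x y hxy
    exact hwlt _ _ (Prod.Lex.toLex_lt_toLex.2 (Or.inr ⟨rfl, Fin.castSucc_lt_castSucc_iff.2 hxy⟩))
  · intro p q x y hpq
    exact hult _ _ (Prod.Lex.toLex_lt_toLex.2 (Or.inl (Fin.castSucc_lt_castSucc_iff.2 hpq)))
  · intro p q x y hpq
    refine hwlt _ _ (Prod.Lex.toLex_lt_toLex.2 (Or.inl ?_))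
    change shiftPerm π p.castSucc < shiftPerm π q.castSucc
    rwa [shiftPerm_castSucc, shiftPerm_castSucc, Fin.succ_lt_succ_iff]
  · intro p q x y
    calc u (toLex (p.castSucc, x.castSucc)) < u (toLex (Fin.last k, Fin.last m)) :=
          hult _ _ (Prod.Lex.toLex_lt_toLex.2 (Or.inl (hlast p)))
      _ < w (toLex (Fin.last k, Fin.last m)) := huw _
      _ < w (toLex (q.castSucc, y.castSucc)) := by
          refine hwlt _ _ (Prod.Lex.toLex_lt_toLex.2 (Or.inl ?_))
          change shiftPerm π (Fin.last k) < shiftPerm π q.castSucc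
          rw [shiftPerm_castSucc, shiftPerm_last]
          exact Fin.succ_pos _
  · intro p x
    exact hadj _

theorem H_mem_of_superExponential {P : Set OrderedGraph} (hP : IsHereditary P)
    (ht : ∃ t : ℕ, K t ∉ P ∧ Kbip t ∉ P) (hS : SuperExponential P) {k : ℕ}
    (π : Equiv.Perm (Fin k)) : H π ∈ P := by
  by_contra hπ
  obtain ⟨t, hK, hB⟩ := ht
  obtain ⟨m, hm⟩ := exists_forall_not_containsPattern hP hK hB hπ
  have : Fintype (Lex (Fin (k + 1) × Fin m)) := inferInstanceAs (Fintype (Fin (k + 1) × Fin m))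
  obtain ⟨c, hc0, hc⟩ := exists_card_avoiders_le (inflation π m)
  obtain ⟨N, hN⟩ := hS c (by exact_mod_cast hc0)
  have hle : speed P N ≤ (avoiders (inflation π m) N).card := by
    rw [speed_eq hP.1, ← Set.ncard_coe_finset]
    refine Set.ncard_le_ncard_of_injOn upperSupport ?_ (upperSupport_injective N).injOn
    intro g hg
    exact mem_avoiders.2 ⟨upperSupport_subset g, hm N g hg⟩
  have h2 : speed P N ≤ c ^ N := hle.trans (hc N)
  exact absurd hN (not_lt.2 (by exact_mod_cast h2))

/-! ### Matchings all of whose left endpoints precede all right endpoints -/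

/-- The ordered graphs of maximum degree at most one in which every left endpoint of an edge
precedes every right endpoint of an edge. -/
def crossingMatchings : Set OrderedGraph :=
  {G | (∀ x y z, G.graph.Adj x y → G.graph.Adj x z → y = z) ∧
    ∀ a b c d, a < b → c < d → G.graph.Adj a b → G.graph.Adj c d → a < d}

theorem crossingMatchings_of_embedding {F G : OrderedGraph} (hG : G ∈ crossingMatchings)
    (f : F.V → G.V) (hf : StrictMono f)
    (hadj : ∀ a b, F.graph.Adj a b → G.graph.Adj (f a) (f b)) : F ∈ crossingMatchings := by
  refine ⟨fun x y z hxy hxz => hf.injective (hG.1 _ _ _ (hadj _ _ hxy) (hadj _ _ hxz)), ?_⟩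
  intro a b c d hab hcd h h'
  exact hf.lt_iff_lt.1 (hG.2 _ _ _ _ (hf hab) (hf hcd) (hadj _ _ h) (hadj _ _ h'))

theorem crossingMatchings_isHereditary : IsHereditary crossingMatchings := by
  refine ⟨fun G F hG h => ?_, fun G hG U => ?_⟩
  · obtain ⟨f, hf⟩ := iso_equivalence.symm h
    exact crossingMatchings_of_embedding hG f f.strictMono fun a b => (hf a b).2
  · exact crossingMatchings_of_embedding hG (fun x : U => x.1) (fun _ _ h => h) fun _ _ h => h

theorem K_notMem_crossingMatchings {t : ℕ} (ht : 3 ≤ t) : K t ∉ crossingMatchings := by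
  intro h
  have h1 := h.1 (⟨0, by omega⟩ : Fin t) (⟨1, by omega⟩ : Fin t) (⟨2, by omega⟩ : Fin t)
    (by simp [K]) (by simp [K])
  simpa using congrArg Fin.val h1

theorem Kbip_notMem_crossingMatchings {t : ℕ} (ht : 3 ≤ t) : Kbip t ∉ crossingMatchings := by
  intro h
  have h1 := h.1 (⟨0, by omega⟩ : Fin (t + t)) (⟨t, by omega⟩ : Fin (t + t))
    (⟨t + 1, by omega⟩ : Fin (t + t)) ((Kbip_adj _ _).2 (by simp [Fin.ext_iff]; omega))
    ((Kbip_adj _ _).2 (by simp [Fin.ext_iff]; omega))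
  simpa using congrArg Fin.val h1

/-! ### Embedding crossing matchings into `H π` -/

section Partner

variable {n : ℕ} {g : SimpleGraph (Fin n)}

open Classical in
/-- The neighbour of `v` if there is one, and `v` otherwise. -/
noncomputable def partner (g : SimpleGraph (Fin n)) (v : Fin n) : Fin n :=
  if h : ∃ w, g.Adj v w then h.choose else v

theorem partner_eq (hg : ofGraph g ∈ crossingMatchings) {v w : Fin n} (h : g.Adj v w) :
    partner g v = w := by
  have h' : ∃ w, g.Adj v w := ⟨w, h⟩
  rw [partner, dif_pos h']
  exact hg.1 v _ _ h'.choose_spec h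

theorem partner_involutive (hg : ofGraph g ∈ crossingMatchings) :
    Function.Involutive (partner g) := by
  intro v
  by_cases h : ∃ w, g.Adj v w
  · obtain ⟨w, hw⟩ := h
    rw [partner_eq hg hw, partner_eq hg hw.symm]
  · have : partner g v = v := dif_neg h
    rw [this, this]

theorem adj_of_partner_eq {v w : Fin n} (hvw : v ≠ w) (h : partner g v = w) : g.Adj v w := by
  by_cases h' : ∃ w, g.Adj v w
  · rw [partner, dif_pos h'] at h
    rw [← h]
    exact h'.choose_spec
  · rw [partner, dif_neg h'] at h
    exact absurd h hvw

end Partner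

/-- Take π to be the partner involution on all n vertices and send each vertex to its left or right
copy in `H π`. An isolated vertex is matched there only to its own other copy, which is not used. -/
theorem ofGraph_mem_of_H_mem {P : Set OrderedGraph} (hP : IsHereditary P)
    (hH : ∀ (k : ℕ) (π : Equiv.Perm (Fin k)), H π ∈ P) {n : ℕ} {g : SimpleGraph (Fin n)}
    (hg : ofGraph g ∈ crossingMatchings) : ofGraph g ∈ P := by
  classical
  let π : Equiv.Perm (Fin n) := (partner_involutive hg).toPerm
  -- Downward closed, so that the embedding is monotone: isolated vertices before the last left
  -- endpoint also go left.
  let isLeft : Fin n → Prop := fun v => ∃ a b, a < b ∧ g.Adj a b ∧ v ≤ a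
  have hdown : ∀ v w, v ≤ w → isLeft w → isLeft v := by
    rintro v w hvw ⟨a, b, hab, h, hw⟩
    exact ⟨a, b, hab, h, hvw.trans hw⟩
  have hright : ∀ c d, c < d → g.Adj c d → ¬ isLeft d := by
    rintro c d hcd h ⟨a, b, hab, h', hd⟩
    exact absurd (hg.2 a b c d hab hcd h' h) (not_lt.2 hd)
  have hleft : ∀ c d, c < d → g.Adj c d → isLeft c := fun c d hcd h => ⟨c, d, hcd, h, le_rfl⟩
  let f : Fin n → Fin (n + n) := fun v => if isLeft v then Fin.castAdd n v else Fin.natAdd n v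
  have hf : StrictMono f := by
    intro v w hvw
    have hd := hdown v w hvw.le
    simp only [f]
    split_ifs with h1 h2 h2
    · exact (Fin.castAddOrderEmb n).strictMono hvw
    · rw [Fin.lt_def, Fin.val_castAdd, Fin.val_natAdd]
      omega
    · exact absurd (hd h2) h1
    · rw [Fin.lt_def, Fin.val_natAdd, Fin.val_natAdd]
      omega
  refine hP.mem_of_embedding (hH n π) f hf ?_
  · intro (v : Fin n) (w : Fin n)
    have hf1 : ∀ v i, f v = Fin.castAdd n i ↔ isLeft v ∧ v = i := by
      intro v i
      simp only [f]
      split_ifs with h <;> simp [h, Fin.ext_iff]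
      omega
    have hf2 : ∀ v i, f v = Fin.natAdd n i ↔ ¬ isLeft v ∧ v = i := by
      intro v i
      simp only [f]
      split_ifs with h <;> simp [h, Fin.ext_iff]
      omega
    rw [H_adj]
    simp only [hf1, hf2]
    change _ ↔ g.Adj v w
    constructor
    · rintro ⟨i, ⟨⟨h1, rfl⟩, h2, h3⟩ | ⟨⟨h1, h2⟩, h3, rfl⟩⟩
      · exact adj_of_partner_eq (by rintro rfl; exact h2 h1) h3.symm
      · exact (adj_of_partner_eq (by rintro rfl; exact h1 h3) h2.symm).symm
    · intro h
      rcases lt_or_gt_of_ne h.ne with hvw | hvw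
      · exact ⟨v, Or.inl ⟨⟨hleft _ _ hvw h, rfl⟩, hright _ _ hvw h, (partner_eq hg h).symm⟩⟩
      · exact ⟨w, Or.inr ⟨⟨hright _ _ hvw h.symm, (partner_eq hg h.symm).symm⟩,
          hleft _ _ hvw h.symm, rfl⟩⟩

theorem crossingMatchings_subset {P : Set OrderedGraph} (hP : IsHereditary P)
    (hH : ∀ (k : ℕ) (π : Equiv.Perm (Fin k)), H π ∈ P) : crossingMatchings ⊆ P := by
  intro G hG
  obtain ⟨g, hg⟩ := exists_iso_ofGraph (G := G) rfl
  exact hP.1 _ _ (ofGraph_mem_of_H_mem hP hH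
    (crossingMatchings_isHereditary.1 _ _ hG (iso_equivalence.symm hg))) hg

theorem subset_sub_of_subset {P : Set OrderedGraph} (h : crossingMatchings ⊆ P) :
    crossingMatchings ⊆ sub P 1 2 := by
  intro G hG
  refine ⟨h hG, fun v => ?_, fun e _ => ?_⟩
  · rw [Set.encard_le_one_iff]
    rintro e e' ⟨he, hve⟩ ⟨he', hve'⟩
    obtain ⟨w, rfl⟩ := hve
    obtain ⟨w', rfl⟩ := hve'
    rw [hG.1 v w w' he he']
  · induction e using Sym2.ind with
    | _ x y =>
      have : {v | v ∈ s(x, y)} = {x, y} := by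
        ext v
        simp
      rw [this]
      refine (Set.encard_insert_le _ _).trans ?_
      rw [Set.encard_singleton]
      norm_num

/-! ### Counting crossing matchings -/

/-- The crossing matching with set `U` of non-isolated vertices and with edges given by `π`. -/
def matchingGraph {n k : ℕ} (U : {U : Finset (Fin n) // U.card = k + k})
    (π : Equiv.Perm (Fin k)) : SimpleGraph (Fin n) where
  Adj x y := ∃ i : Fin k,
    (x = U.1.orderEmbOfFin U.2 (Fin.castAdd k i) ∧
      y = U.1.orderEmbOfFin U.2 (Fin.natAdd k (π i))) ∨
    (x = U.1.orderEmbOfFin U.2 (Fin.natAdd k (π i)) ∧ y = U.1.orderEmbOfFin U.2 (Fin.castAdd k i))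
  symm.symm x y := by
    rintro ⟨i, h | h⟩
    exacts [⟨i, Or.inr h.symm⟩, ⟨i, Or.inl h.symm⟩]
  loopless.irrefl x := by
    rintro ⟨i, ⟨h1, h2⟩ | ⟨h1, h2⟩⟩ <;>
    · have := congrArg Fin.val ((U.1.orderEmbOfFin U.2).injective (h1.symm.trans h2))
      simp at this
      omega

theorem matchingGraph_adj {n k : ℕ} (U : {U : Finset (Fin n) // U.card = k + k})
    (π : Equiv.Perm (Fin k)) (x y : Fin (k + k)) :
    (matchingGraph U π).Adj (U.1.orderEmbOfFin U.2 x) (U.1.orderEmbOfFin U.2 y) ↔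
      (H π).graph.Adj x y := by
  rw [H_adj]
  simp only [matchingGraph, EmbeddingLike.apply_eq_iff_eq]

theorem mem_iff_exists_matchingGraph_adj {n k : ℕ} (U : {U : Finset (Fin n) // U.card = k + k})
    (π : Equiv.Perm (Fin k)) (x : Fin n) : x ∈ U.1 ↔ ∃ y, (matchingGraph U π).Adj x y := by
  constructor
  · intro hx
    rw [← Finset.mem_coe, ← Finset.range_orderEmbOfFin U.1 U.2] at hx
    obtain ⟨i, rfl⟩ := hx
    induction i using Fin.addCases with
    | left i => exact ⟨_, i, Or.inl ⟨rfl, rfl⟩⟩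
    | right i => exact ⟨_, π.symm i, Or.inr ⟨by simp, rfl⟩⟩
  · rintro ⟨y, i, ⟨rfl, -⟩ | ⟨rfl, -⟩⟩ <;> exact Finset.orderEmbOfFin_mem _ _ _

theorem ofGraph_matchingGraph_mem {n k : ℕ} (U : {U : Finset (Fin n) // U.card = k + k})
    (π : Equiv.Perm (Fin k)) : ofGraph (matchingGraph U π) ∈ crossingMatchings := by
  set e := U.1.orderEmbOfFin U.2
  have hlt : ∀ i j, e (Fin.castAdd k i) < e (Fin.natAdd k j) := by
    intro i j
    rw [OrderEmbedding.lt_iff_lt, Fin.lt_def]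
    simp only [Fin.val_castAdd, Fin.val_natAdd]
    omega
  have hne : ∀ i j, e (Fin.castAdd k i) ≠ e (Fin.natAdd k j) := fun i j => (hlt i j).ne
  have hc : ∀ i j, e (Fin.castAdd k i) = e (Fin.castAdd k j) → i = j := fun i j h =>
    Fin.castAdd_injective _ _ (e.injective h)
  have hn : ∀ i j, e (Fin.natAdd k (π i)) = e (Fin.natAdd k (π j)) → i = j := fun i j h =>
    π.injective (Fin.natAdd_injective _ _ (e.injective h))
  constructor
  · rintro x y z ⟨i, ⟨rfl, rfl⟩ | ⟨rfl, rfl⟩⟩ ⟨j, ⟨h1, rfl⟩ | ⟨h1, rfl⟩⟩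
    · rw [hc i j h1]
    · exact absurd h1 (hne _ _)
    · exact absurd h1.symm (hne _ _)
    · rw [hn i j h1]
  · rintro a b c d hab hcd ⟨i, ⟨rfl, rfl⟩ | ⟨rfl, rfl⟩⟩ ⟨j, ⟨rfl, rfl⟩ | ⟨rfl, rfl⟩⟩
    · exact hlt _ _
    · exact absurd hcd (hlt _ _).not_gt
    · exact absurd hab (hlt _ _).not_gt
    · exact absurd hab (hlt _ _).not_gt

/-- The left endpoints L precede the right endpoints R, so the increasing enumeration of L ∪ R lists
L and then R, and π is the partner bijection read in these enumerations. -/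
theorem exists_matchingGraph_eq {n : ℕ} {g : SimpleGraph (Fin n)}
    (hg : ofGraph g ∈ crossingMatchings) :
    ∃ (k : ℕ) (U : {U : Finset (Fin n) // U.card = k + k}) (π : Equiv.Perm (Fin k)),
      matchingGraph U π = g := by
  classical
  set L : Finset (Fin n) := Finset.univ.filter fun i => ∃ j, i < j ∧ g.Adj i j with hL
  set R : Finset (Fin n) := Finset.univ.filter fun j => ∃ i, i < j ∧ g.Adj i j with hR
  have memL : ∀ i, i ∈ L ↔ ∃ j, i < j ∧ g.Adj i j := by simp [hL]
  have memR : ∀ j, j ∈ R ↔ ∃ i, i < j ∧ g.Adj i j := by simp [hR]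
  have hLR : ∀ i ∈ L, ∀ j ∈ R, i < j := by
    intro i hi j hj
    obtain ⟨i', hi', h1⟩ := (memL i).1 hi
    obtain ⟨j', hj', h2⟩ := (memR j).1 hj
    exact hg.2 i i' j' j hi' hj' h1 h2
  have pL : ∀ i ∈ L, g.Adj i (partner g i) ∧ partner g i ∈ R := by
    intro i hi
    obtain ⟨j, hij, h⟩ := (memL i).1 hi
    rw [partner_eq hg h]
    exact ⟨h, (memR j).2 ⟨i, hij, h⟩⟩
  have pR : ∀ j ∈ R, partner g j ∈ L := by
    intro j hj
    obtain ⟨i, hij, h⟩ := (memR j).1 hj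
    rw [partner_eq hg h.symm]
    exact (memL i).2 ⟨j, hij, h⟩
  let E : L ≃ R :=
    { toFun := fun i => ⟨partner g i, (pL i i.2).2⟩
      invFun := fun j => ⟨partner g j, pR j j.2⟩
      left_inv := fun i => Subtype.ext (partner_involutive hg i)
      right_inv := fun j => Subtype.ext (partner_involutive hg j) }
  have hcard : R.card = L.card := by
    simpa using (Fintype.card_congr E).symm
  set k := L.card
  let eL := L.orderIsoOfFin (rfl : L.card = k)
  let eR := R.orderIsoOfFin hcard
  let π : Equiv.Perm (Fin k) := (eL.toEquiv.trans E).trans eR.symm.toEquiv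
  have hdisj : Disjoint L R := by
    rw [Finset.disjoint_left]
    exact fun i hi hi' => lt_irrefl _ (hLR i hi i hi')
  let U : {U : Finset (Fin n) // U.card = k + k} :=
    ⟨L ∪ R, by rw [Finset.card_union_of_disjoint hdisj, hcard]⟩
  have he := Finset.orderEmbOfFin_unique U.2
    (f := Fin.addCases (fun i => (eL i : Fin n)) (fun i => (eR i : Fin n)))
    (fun x => by
      induction x using Fin.addCases with
      | left i =>
        rw [Fin.addCases_left]
        exact Finset.mem_union_left R (eL i).2
      | right i =>
        rw [Fin.addCases_right]
        exact Finset.mem_union_right L (eR i).2)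
    (strictMono_addCases (fun i j h => eL.strictMono h) (fun i j h => eR.strictMono h)
      fun i j => hLR _ (eL i).2 _ (eR j).2)
  have heL : ∀ i, U.1.orderEmbOfFin U.2 (Fin.castAdd k i) = eL i := fun i => by
    rw [← he]
    exact Fin.addCases_left i
  have heR : ∀ i, U.1.orderEmbOfFin U.2 (Fin.natAdd k (π i)) = partner g (eL i) := fun i => by
    rw [← he]
    refine (Fin.addCases_right (π i)).trans ?_
    simp [π, E]
  refine ⟨k, U, π, ?_⟩
  have hlt : ∀ x y, x < y → g.Adj x y → (matchingGraph U π).Adj x y := by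
    intro x y hxy h
    refine ⟨eL.symm ⟨x, (memL x).2 ⟨y, hxy, h⟩⟩, Or.inl ⟨?_, ?_⟩⟩
    · rw [heL]
      simp
    · rw [heR]
      simp [partner_eq hg h]
  ext x y
  constructor
  · rintro ⟨i, ⟨rfl, rfl⟩ | ⟨rfl, rfl⟩⟩
    · rw [heL, heR]
      exact (pL _ (eL i).2).1
    · rw [heL, heR]
      exact (pL _ (eL i).2).1.symm
  · intro h
    rcases lt_or_gt_of_ne h.ne with hxy | hxy
    · exact hlt x y hxy h
    · exact (hlt y x hxy h.symm).symm

theorem speed_crossingMatchings (n : ℕ) : speed crossingMatchings n = bound n := by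
  rw [speed_eq crossingMatchings_isHereditary.1]
  let D := Σ k : Fin (n / 2 + 1),
    {U : Finset (Fin n) // U.card = k.val + k.val} × Equiv.Perm (Fin k.val)
  let Φ : D → SimpleGraph (Fin n) := fun d => matchingGraph d.2.1 d.2.2
  have hinj : Function.Injective Φ := by
    rintro ⟨⟨k, hk⟩, U, π⟩ ⟨⟨k', hk'⟩, U', π'⟩ h
    change matchingGraph U π = matchingGraph U' π' at h
    -- U is recovered as the set of non-isolated vertices; its size gives k, and the edges then give
    -- π.
    have hU : U.1 = U'.1 := by
      ext x
      rw [mem_iff_exists_matchingGraph_adj U π, mem_iff_exists_matchingGraph_adj U' π', h]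
    obtain rfl : k = k' := by
      have h1 := U.2
      have h2 := U'.2
      rw [hU] at h1
      simp only at h1 h2
      omega
    obtain rfl : U = U' := Subtype.ext hU
    obtain rfl : π = π' := by
      ext1 i
      have h1 := (matchingGraph_adj U π (Fin.castAdd k i) (Fin.natAdd k (π i))).2
        ((H_adj _ _ _).2 ⟨i, Or.inl ⟨rfl, rfl⟩⟩)
      rw [h, matchingGraph_adj, H_adj] at h1
      obtain ⟨j, ⟨h2, h3⟩ | ⟨h2, -⟩⟩ := h1
      · rw [Fin.castAdd_injective _ _ h2] at h3 ⊢
        exact Fin.natAdd_injective _ _ h3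
      · have := congrArg Fin.val h2
        simp at this
        omega
    rfl
  have hrange : {g : SimpleGraph (Fin n) | ofGraph g ∈ crossingMatchings} = Φ '' Set.univ := by
    ext g
    simp only [Set.image_univ, Set.mem_range, Set.mem_ofPred_eq]
    constructor
    · intro hg
      obtain ⟨k, U, π, rfl⟩ := exists_matchingGraph_eq hg
      have hk : k + k ≤ n := by
        rw [← U.2]
        simpa using Finset.card_le_univ U.1
      exact ⟨⟨⟨k, by omega⟩, U, π⟩, rfl⟩
    · rintro ⟨d, rfl⟩
      exact ofGraph_matchingGraph_mem _ _
  rw [hrange, Set.ncard_image_of_injective _ hinj, Set.ncard_univ, Nat.card_eq_fintype_card,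
    Fintype.card_sigma, bound, Finset.sum_range]
  refine Finset.sum_congr rfl fun k _ => ?_
  rw [Fintype.card_prod, Fintype.card_finset_len, Fintype.card_perm, Fintype.card_fin,
    Fintype.card_fin, two_mul]

/-! ### Asymptotics of the bound -/

theorem factorial_le_bound (n : ℕ) : (n / 2).factorial ≤ bound n := by
  refine le_trans ?_ (Finset.single_le_sum
    (f := fun k => n.choose (2 * k) * k.factorial) (fun _ _ => Nat.zero_le _)
    (Finset.mem_range.2 (Nat.lt_succ_self (n / 2))))
  exact Nat.le_mul_of_pos_left _ (Nat.choose_pos (by omega))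

theorem bound_le (n : ℕ) : bound n ≤ 4 ^ n * (n / 2).factorial := by
  have h : ∀ k ∈ Finset.range (n / 2 + 1),
      n.choose (2 * k) * k.factorial ≤ 2 ^ n * (n / 2).factorial := fun k hk =>
    Nat.mul_le_mul (Nat.choose_le_two_pow _ _)
      (Nat.factorial_le (Nat.lt_succ_iff.1 (Finset.mem_range.1 hk)))
  refine (Finset.sum_le_card_nsmul _ _ _ h).trans ?_
  rw [Finset.card_range, smul_eq_mul, ← mul_assoc]
  refine Nat.mul_le_mul_right _ ?_
  rw [show 4 = 2 * 2 from rfl, mul_pow]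
  have := Nat.lt_two_pow_self (n := n)
  rcases n.eq_zero_or_pos with rfl | hn
  · simp
  · exact Nat.mul_le_mul_right _ (by omega)

theorem bound_superExponential {P : Set OrderedGraph} (hP : ∀ n, speed P n = bound n) :
    SuperExponential P := by
  intro c hc
  have h := (FloorSemiring.tendsto_pow_div_factorial_atTop (c ^ 2)).eventually_lt_const one_pos
  obtain ⟨m, hm⟩ := h.exists
  rw [div_lt_one (by positivity)] at hm
  refine ⟨2 * m, ?_⟩
  rw [hP, pow_mul]
  refine hm.trans_le ?_
  have := factorial_le_bound (2 * m)
  rw [Nat.mul_div_cancel_left _ two_pos] at this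
  exact_mod_cast this

theorem abs_log_bound_sub_le {n : ℕ} (hn : 2 ≤ n) :
    |Real.log (bound n) - n / 2 * Real.log n| ≤ 2 * n := by
  have hn2 : (2 : ℝ) ≤ n := by exact_mod_cast hn
  have hn0 : (0 : ℝ) < n := by linarith
  have hl2 : Real.log 2 < 0.6931471808 := Real.log_two_lt_d9
  have hl0 : 0 < Real.log 2 := Real.log_pos (by norm_num)
  have hlog : 0 ≤ Real.log n := Real.log_nonneg (by linarith)
  have hlogle : Real.log n ≤ n := Real.log_le_self hn0.le
  have hm1 : ((n / 2 : ℕ) : ℝ) ≤ n / 2 := Nat.cast_div_le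
  have hm2 : (n : ℝ) / 2 - 1 / 2 ≤ ((n / 2 : ℕ) : ℝ) := by
    have : n ≤ 2 * (n / 2) + 1 := by omega
    have : (n : ℝ) ≤ 2 * ((n / 2 : ℕ) : ℝ) + 1 := by exact_mod_cast this
    linarith
  set m := n / 2 with hm
  have hmpos : (0 : ℝ) < m := by
    have : 0 < m := by omega
    exact_mod_cast this
  have hfac : (0 : ℝ) < m.factorial := by exact_mod_cast m.factorial_pos
  have hlow : (m.factorial : ℝ) ≤ bound n := by exact_mod_cast factorial_le_bound n
  have hb0 : (0 : ℝ) < bound n := hfac.trans_le hlow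
  have hhalf : Real.log (n / 2) = Real.log n - Real.log 2 := Real.log_div hn0.ne' (by norm_num)
  have hhalf0 : 0 ≤ Real.log ((n : ℝ) / 2) := Real.log_nonneg (by linarith)
  rw [abs_le]
  constructor
  -- From x^m/m! ≤ e^x at x = n/2, log m! ≥ m·log(n/2) − n/2.
  · have h1 := Real.pow_div_factorial_le_exp ((n : ℝ) / 2) (by positivity) m
    rw [div_le_iff₀ hfac] at h1
    have h2 := Real.log_le_log (by positivity) h1
    rw [Real.log_mul (Real.exp_pos _).ne' hfac.ne', Real.log_exp, Real.log_pow] at h2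
    have h3 := Real.log_le_log hfac hlow
    have h4 := mul_le_mul_of_nonneg_right hm2 hhalf0
    rw [hhalf] at h2 h4
    nlinarith
  · have h1 : (bound n : ℝ) ≤ 4 ^ n * m.factorial := by exact_mod_cast bound_le n
    have h2 : (m.factorial : ℝ) ≤ (m : ℝ) ^ m := by exact_mod_cast m.factorial_le_pow
    have h3 : (bound n : ℝ) ≤ 4 ^ n * (m : ℝ) ^ m :=
      h1.trans (mul_le_mul_of_nonneg_left h2 (by positivity))
    have h4 := Real.log_le_log hb0 h3
    rw [Real.log_mul (by positivity) (by positivity), Real.log_pow, Real.log_pow,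
      show (4 : ℝ) = 2 ^ 2 by norm_num, Real.log_pow] at h4
    have h5 : Real.log m ≤ Real.log n := Real.log_le_log hmpos (by linarith)
    have h6 : (m : ℝ) * Real.log m ≤ n / 2 * Real.log n := by
      calc (m : ℝ) * Real.log m ≤ m * Real.log n := mul_le_mul_of_nonneg_left h5 hmpos.le
        _ ≤ n / 2 * Real.log n := mul_le_mul_of_nonneg_right hm1 hlog
    push_cast at h4
    nlinarith

theorem bound_eq_rpow : ∃ e : ℕ → ℝ, e =o[atTop] (fun n : ℕ => (n : ℝ)) ∧
    ∀ n : ℕ, (bound n : ℝ) = (n : ℝ) ^ ((n : ℝ) / 2 + e n) := by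
  have hlogpos : ∀ n : ℕ, 2 ≤ n → 0 < Real.log n := fun n hn =>
    Real.log_pos (by exact_mod_cast (by omega : 1 < n))
  -- Here log n vanishes in the denominator for n < 2; exponent error 0 is right there, because 0^0
  -- = 1 and 1^(1/2) = 1.
  refine ⟨fun n => if n < 2 then 0 else Real.log (bound n) / Real.log n - n / 2, ?_, ?_⟩
  · rw [isLittleO_iff]
    intro c hc
    have h : Tendsto (fun n : ℕ => Real.log n) atTop atTop :=
      Real.tendsto_log_atTop.comp tendsto_natCast_atTop_atTop
    filter_upwards [h.eventually_ge_atTop (2 / c), eventually_ge_atTop 2] with n h1 h2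
    have hl := hlogpos n h2
    rw [if_neg (by omega), Real.norm_eq_abs, Real.norm_natCast]
    have h3 := abs_log_bound_sub_le h2
    have h4 : Real.log (bound n) / Real.log n - n / 2 =
        (Real.log (bound n) - n / 2 * Real.log n) / Real.log n := by
      field_simp
    rw [h4, abs_div, abs_of_pos hl, div_le_iff₀ hl]
    rw [div_le_iff₀ hc] at h1
    have hn : (0 : ℝ) ≤ n := Nat.cast_nonneg n
    nlinarith
  · intro n
    beta_reduce
    split_ifs with h
    · interval_cases n <;> simp [bound]
    · have hl := hlogpos n (by omega)
      have hn : (0 : ℝ) < n := by exact_mod_cast (by omega : 0 < n)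
      have hb : (0 : ℝ) < bound n := by
        exact_mod_cast (Nat.factorial_pos _).trans_le (factorial_le_bound n)
      rw [add_sub_cancel, Real.rpow_def_of_pos hn, mul_div_cancel₀ _ hl.ne', Real.exp_log hb]

/-! ### Uniqueness of the extremal property -/

theorem eq_crossingMatchings {P : Set OrderedGraph} (hP : IsHereditary P)
    (ht : ∃ t : ℕ, K t ∉ P ∧ Kbip t ∉ P) (hs : ∀ n, speed P n = bound n) :
    P = crossingMatchings := by
  have hsub := crossingMatchings_subset hP fun k π =>
    H_mem_of_superExponential hP ht (bound_superExponential hs) π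
  refine Set.Subset.antisymm (fun G hG => ?_) hsub
  -- Nested finite sets of classes with equal cardinality coincide.
  have heq : classes crossingMatchings G.order = classes P G.order :=
    Set.eq_of_subset_of_ncard_le (classes_mono hsub _)
      ((hs _).trans (speed_crossingMatchings _).symm).le (classes_finite _ _)
  have : Quotient.mk isoSetoid G ∈ classes crossingMatchings G.order := by
    rw [heq]
    exact ⟨G, ⟨hG, rfl⟩, rfl⟩
  obtain ⟨F, ⟨hF, -⟩, h⟩ := this
  exact crossingMatchings_isHereditary.1 F G hF (Quotient.exact h)

end OrderedGraph

theorem mainTheorem5 :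
    (∀ P : Set OrderedGraph, OrderedGraph.IsHereditary P →
      (∃ t : ℕ, OrderedGraph.K t ∉ P ∧ OrderedGraph.Kbip t ∉ P) →
      OrderedGraph.SuperExponential P →
        (∀ (k : ℕ) (π : Equiv.Perm (Fin k)), OrderedGraph.H π ∈ P) ∧
        ∀ n : ℕ,
          OrderedGraph.speed (OrderedGraph.sub P 1 2) n ≤ OrderedGraph.speed P n ∧
          OrderedGraph.bound n ≤ OrderedGraph.speed (OrderedGraph.sub P 1 2) n) ∧
    (∃ e : ℕ → ℝ, e =o[atTop] (fun n : ℕ => (n : ℝ)) ∧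
      ∀ n : ℕ, (OrderedGraph.bound n : ℝ) = (n : ℝ) ^ ((n : ℝ) / 2 + e n)) ∧
    ∃ Q : Set OrderedGraph,
      OrderedGraph.IsHereditary Q ∧
      (∀ t : ℕ, 3 ≤ t → OrderedGraph.K t ∉ Q ∧ OrderedGraph.Kbip t ∉ Q) ∧
      OrderedGraph.SuperExponential Q ∧
      (∀ n : ℕ, OrderedGraph.speed Q n = OrderedGraph.bound n) ∧
      ∀ P : Set OrderedGraph, OrderedGraph.IsHereditary P →
        (∃ t : ℕ, OrderedGraph.K t ∉ P ∧ OrderedGraph.Kbip t ∉ P) →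
        (∀ n : ℕ, OrderedGraph.speed P n = OrderedGraph.bound n) → P = Q := by
  refine ⟨fun P hP ht hS => ?_, OrderedGraph.bound_eq_rpow, OrderedGraph.crossingMatchings,
    OrderedGraph.crossingMatchings_isHereditary,
    fun t ht => ⟨OrderedGraph.K_notMem_crossingMatchings ht,
      OrderedGraph.Kbip_notMem_crossingMatchings ht⟩,
    OrderedGraph.bound_superExponential OrderedGraph.speed_crossingMatchings,
    OrderedGraph.speed_crossingMatchings, fun P hP ht hs => OrderedGraph.eq_crossingMatchings hP ht hs⟩
  have hH : ∀ (k : ℕ) (π : Equiv.Perm (Fin k)), OrderedGraph.H π ∈ P := fun k π =>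
    OrderedGraph.H_mem_of_superExponential hP ht hS π
  refine ⟨hH, fun n => ⟨OrderedGraph.speed_mono (fun G hG => hG.1) n, ?_⟩⟩
  rw [← OrderedGraph.speed_crossingMatchings]
  exact OrderedGraph.speed_mono (OrderedGraph.subset_sub_of_subset
    (OrderedGraph.crossingMatchings_subset hP hH)) n
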